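/- Assume $2^{\omega_1}=\omega_2$. Let $H(\omega_2)$ be the collection of sets hereditarily of cardinality less than $\omega_2$, and fix a bijection $\pi:\omega_2\to H(\omega_2)$. Let $\mathcal Y$ be a stationary subset of $P_{\omega_1}(\omega_2)$ (the set of countable subsets of $\omega_2$) which is thin, i.e. $|\{a\cap\beta : a\in\mathcal Y\}|\le\omega_1$ for every $\beta<\omega_2$, and which is closed under initial segments, i.e. $a\cap\beta\in\mathcal Y$ for all $a\in\mathcal Y$ and $\beta<\omega_2$. Let $\mathcal A=(H(\omega_2),\in,\pi,\mathcal Y)$, fix a set of definable Skolem functions for $\mathcal A$ (functions definable in $\mathcal A$ without parameters, including a Skolem function for every formula), and for $a\subseteq H(\omega_2)$ let $Sk(a)$ be the closure of $a$ under these functions. Let: - $C$ be the set of $\beta<\omega_2$ with $Sk(\beta)\cap\omega_2=\beta$; - $\Lambda$ be the set of $\beta<\omega_2$ of cofinality $\omega_1$ which are limit points of $C$; - $\mathcal X$ be the set of $M\in\mathcal Y$ such that $Sk(M)\cap\omega_2=M$ and $\sup(C\cap\gamma)\in M$ for all $\gamma\in M$. Fix a set $\Gamma\subseteq\Lambda$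 which is stationary in $\omega_2$. For $M\in\mathcal X$ let $\Gamma_M$ be the set of $\beta\in\Gamma$ such that $\beta=\min(\Gamma\setminus\sup(M\cap\beta))$, and for $M,N\in\mathcal X$ let $\beta_{M,N}$ be the largest element of $\Gamma_M\cap\Gamma_N$. A set $A\subseteq\mathcal X$ is called adequate if for all $M,N\in A$, either $M\cap\beta_{M,N}=N\cap\beta_{M,N}$, or $M\cap\beta_{M,N}\in Sk(N)$, or $N\cap\beta_{M,N}\in Sk(M)$. Let $\mathbb P$ be the forcing poset whose conditions are the finite adequate sets, ordered by $B\le A$ if $A\subseteq B$. Then $\mathbb P$ is $\omega_2$-c.c.; that is, every set of pairwise incompatible conditions of $\mathbb P$ has cardinality less than $\omega_2$. -/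

import Mathlib

open Cardinal Ordinal Set

/-! Ordinals are elements of `Ordinal.{0}`; an ordinal `β` regarded as a set of ordinals is `Iio β`,
in particular `ω₂` is `Iio (ω_ 2)`. The universe of sets is `ZFSet.{0}`, in which the ordinal `α` is
the von Neumann ordinal `α.toZFSet`. -/

namespace AdequateSets

/-- `H(ω₂)`: the sets which are hereditarily of cardinality less than `ω₂` (as `ω₂` is regular,
these are the sets whose transitive closure has cardinality less than `ω₂`). -/
def HOmegaTwo : Type 1 :=
  {x : ZFSet.{0} // x.Hereditarily (fun y => y.card < ℵ_ 2)}

/-- The element `x` of `H(ω₂)` is the set of ordinals `a`. -/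
def Codes (x : HOmegaTwo) (a : Set Ordinal.{0}) : Prop :=
  (x.1 : Set ZFSet.{0}) = Ordinal.toZFSet '' a

/-- A set of ordinals, as a subset of `H(ω₂)`. -/
def toH (a : Set Ordinal.{0}) : Set HOmegaTwo :=
  {x | ∃ α ∈ a, x.1 = α.toZFSet}

/-- `B ∩ ω₂` for `B ⊆ H(ω₂)`. -/
def ordPart (B : Set HOmegaTwo) : Set Ordinal.{0} :=
  {α | α < ω_ 2 ∧ ∃ x ∈ B, x.1 = α.toZFSet}

/-- For a set of ordinals `a` and `B ⊆ H(ω₂)`: the set `a` is an element of `B`. -/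
def MemH (a : Set Ordinal.{0}) (B : Set HOmegaTwo) : Prop :=
  ∃ x ∈ B, Codes x a

/-! ### The stationary set of countable models -/

/-- `P_{ω₁}(ω₂)`, the set of countable subsets of `ω₂`. -/
def countableSubsets : Set (Set Ordinal.{0}) :=
  {a | a ⊆ Iio (ω_ 2) ∧ a.Countable}

/-- `K` is closed and unbounded in `P_{ω₁}(ω₂)`. -/
structure IsClubCountable (K : Set (Set Ordinal.{0})) : Prop where
  subset : K ⊆ countableSubsets
  unbounded : ∀ a ∈ countableSubsets, ∃ b ∈ K, a ⊆ b
  closed : ∀ f : ℕ → Set Ordinal.{0}, Monotone f → (∀ n, f n ∈ K) → (⋃ n, f n) ∈ K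

/-- `Y` is a stationary subset of `P_{ω₁}(ω₂)`. -/
def IsStationaryCountable (Y : Set (Set Ordinal.{0})) : Prop :=
  Y ⊆ countableSubsets ∧ ∀ K, IsClubCountable K → (Y ∩ K).Nonempty

/-- `Y` is thin: for all `β < ω₂`, the set `{a ∩ β : a ∈ Y}` has size at most `ω₁`. -/
def IsThin (Y : Set (Set Ordinal.{0})) : Prop :=
  ∀ β < ω_ 2, #((fun a : Set Ordinal.{0} => a ∩ Iio β) '' Y) ≤ ℵ_ 1

/-- `Y` is closed under initial segments. -/
def InitialSegmentClosed (Y : Set (Set Ordinal.{0})) : Prop :=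
  ∀ a ∈ Y, ∀ β < ω_ 2, a ∩ Iio β ∈ Y

/-! ### The structure `𝒜 = (H(ω₂), ∈, π, Y)` and Skolem hulls -/

/-- The relation symbols of the language of `𝒜`; `π` is regarded as a binary relation. -/
inductive Rel : ℕ → Type
  | mem : Rel 2
  | pi : Rel 2
  | thin : Rel 1

/-- The language of `𝒜`. -/
def lang : FirstOrder.Language.{0, 0} := ⟨fun _ => Empty, Rel⟩

/-- The interpretation of the relation symbols in `𝒜`. -/
def interp (π : Iio (ω_ 2 : Ordinal.{0}) ≃ HOmegaTwo) (Y : Set (Set Ordinal.{0})) :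
    {n : ℕ} → Rel n → (Fin n → HOmegaTwo) → Prop
  | _, .mem, v => (v 0).1 ∈ (v 1).1
  | _, .pi, v => ∃ α : Iio (ω_ 2 : Ordinal.{0}), (v 0).1 = α.1.toZFSet ∧ v 1 = π α
  | _, .thin, v => ∃ a ∈ Y, Codes (v 0) a

/-- The structure `𝒜 = (H(ω₂), ∈, π, Y)`. -/
@[reducible] def structA (π : Iio (ω_ 2 : Ordinal.{0}) ≃ HOmegaTwo)
    (Y : Set (Set Ordinal.{0})) : lang.Structure HOmegaTwo where
  funMap := fun f => nomatch f
  RelMap := fun r v => interp π Y r v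

/-- `S` is a set of definable Skolem functions for `𝒜`: every member of `S` is a finitary function
on `H(ω₂)` which is definable in `𝒜` without parameters, and every formula
`φ(y, x₀, …, xₙ₋₁)` has a Skolem function in `S`. -/
structure IsDefinableSkolemSet (π : Iio (ω_ 2 : Ordinal.{0}) ≃ HOmegaTwo)
    (Y : Set (Set Ordinal.{0})) (S : Set (Σ n : ℕ, (Fin n → HOmegaTwo) → HOmegaTwo)) : Prop where
  definable : letI := structA π Y
    ∀ F ∈ S, (∅ : Set HOmegaTwo).DefinableFun lang F.2
  skolem : letI := structA π Y
    ∀ (n : ℕ) (φ : lang.Formula (Option (Fin n))),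
      ∃ f : (Fin n → HOmegaTwo) → HOmegaTwo, (⟨n, f⟩ : Σ n, (Fin n → HOmegaTwo) → HOmegaTwo) ∈ S ∧
        ∀ x : Fin n → HOmegaTwo, (∃ y, φ.Realize (fun i => i.elim y x)) →
          φ.Realize (fun i => i.elim (f x) x)

/-- `Sk(a)`: the closure of `a ⊆ H(ω₂)` under the functions in `S`. -/
def Sk (S : Set (Σ n : ℕ, (Fin n → HOmegaTwo) → HOmegaTwo)) (a : Set HOmegaTwo) :
    Set HOmegaTwo :=
  ⋂₀ {B | a ⊆ B ∧ ∀ F ∈ S, ∀ x : Fin F.1 → HOmegaTwo, (∀ i, x i ∈ B) → F.2 x ∈ B}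

/-- `C`: the set of `β < ω₂` such that `Sk(β) ∩ ω₂ = β`. -/
def clubC (S : Set (Σ n : ℕ, (Fin n → HOmegaTwo) → HOmegaTwo)) : Set Ordinal.{0} :=
  {β | β < ω_ 2 ∧ ordPart (Sk S (toH (Iio β))) = Iio β}

/-- `Λ`: the set of `β < ω₂` of cofinality `ω₁` which are limit points of `C`. -/
def Lam (S : Set (Σ n : ℕ, (Fin n → HOmegaTwo) → HOmegaTwo)) : Set Ordinal.{0} :=
  {β | β < ω_ 2 ∧ β.cof = ℵ_ 1 ∧ ∀ γ < β, ∃ δ ∈ clubC S, γ < δ ∧ δ < β}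

/-- `𝒳`: the set of `M ∈ Y` such that `Sk(M) ∩ ω₂ = M` and `sup (C ∩ γ) ∈ M` for all `γ ∈ M`.
(The supremum of the empty set is `0`.) -/
def models (Y : Set (Set Ordinal.{0}))
    (S : Set (Σ n : ℕ, (Fin n → HOmegaTwo) → HOmegaTwo)) : Set (Set Ordinal.{0}) :=
  {M | M ∈ Y ∧ ordPart (Sk S (toH M)) = M ∧ ∀ γ ∈ M, sSup (clubC S ∩ Iio γ) ∈ M}

/-! ### Comparison points, adequate sets and the forcing poset -/

/-- `Γ_M`: the set of `β ∈ Γ` such that `β = min (Γ \ sup (M ∩ β))`. -/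
def gammaSet (Γ M : Set Ordinal.{0}) : Set Ordinal.{0} :=
  {β | β ∈ Γ ∧ IsLeast {γ | γ ∈ Γ ∧ sSup (M ∩ Iio β) ≤ γ} β}

/-- `β_{M,N}`: the largest element of `Γ_M ∩ Γ_N`. (If a set of ordinals has a largest element,
then its supremum is that element.) -/
noncomputable def comparisonPoint (Γ M N : Set Ordinal.{0}) : Ordinal.{0} :=
  sSup (gammaSet Γ M ∩ gammaSet Γ N)

/-- `A ⊆ 𝒳` is adequate: for all `M, N ∈ A`, with `β = β_{M,N}`, either `M ∩ β = N ∩ β`,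
`M ∩ β ∈ Sk(N)`, or `N ∩ β ∈ Sk(M)`. -/
def IsAdequate (Y : Set (Set Ordinal.{0}))
    (S : Set (Σ n : ℕ, (Fin n → HOmegaTwo) → HOmegaTwo)) (Γ : Set Ordinal.{0})
    (A : Set (Set Ordinal.{0})) : Prop :=
  A ⊆ models Y S ∧ ∀ M ∈ A, ∀ N ∈ A,
    M ∩ Iio (comparisonPoint Γ M N) = N ∩ Iio (comparisonPoint Γ M N) ∨
    MemH (M ∩ Iio (comparisonPoint Γ M N)) (Sk S (toH N)) ∨
    MemH (N ∩ Iio (comparisonPoint Γ M N)) (Sk S (toH M))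

/-- The conditions of the forcing poset: the finite adequate sets. -/
structure Condition (Y : Set (Set Ordinal.{0}))
    (S : Set (Σ n : ℕ, (Fin n → HOmegaTwo) → HOmegaTwo)) (Γ : Set Ordinal.{0}) : Type 1 where
  models : Set (Set Ordinal.{0})
  finite : models.Finite
  adequate : IsAdequate Y S Γ models

/-- `B ≤ A` if `A ⊆ B`. -/
instance (Y : Set (Set Ordinal.{0})) (S : Set (Σ n : ℕ, (Fin n → HOmegaTwo) → HOmegaTwo))
    (Γ : Set Ordinal.{0}) : Preorder (Condition Y S Γ) where
  le B A := A.models ⊆ B.models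
  le_refl _ := Subset.rfl
  le_trans _ _ _ h₁ h₂ := h₂.trans h₁

/-- A forcing poset is `κ`-c.c. if every antichain (a set of conditions no two distinct members of
which have a common lower bound) has cardinality less than `κ`. -/
def IsCC (P : Type*) [Preorder P] (κ : Cardinal) : Prop :=
  ∀ A : Set P, (∀ p ∈ A, ∀ q ∈ A, p ≠ q → ¬ ∃ r, r ≤ p ∧ r ≤ q) → #A < κ

end AdequateSets

/-! Suppose `p β`, for β < ω₂, are distinct members of an antichain. At β ∈ Γ take the trace {M ∩ β
: M ∈ p β}. As cf β = ω₁ and the members of `p β` are finitely many countable sets, the trace lives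
below some η < β, so thinness leaves only ℵ₁ candidates per η. By pressing down
(`exists_unbounded_fiber`) there are β' < β in Γ with equal traces and with all members of `p β'`
included in β. The union of `p β` and `p β'` is then adequate, a contradiction.

For M in `p β` and N in `p β'`, pick M' in `p β'` with M' ∩ β' = M ∩ β. Every common comparison
point of M and N is at most β' and is one for M' and N (`gammaSet_inter_transfer`), so the relation
between M' and N restricts to β_{M,N}, where M and M' agree. The delicate case is N ∩ β_{M,N} ∈
Sk(M'): by thinness its π-index is below β' (`symm_lt_of_codes`), hence lies in M' ∩ β' ⊆ M, and π
returns the set to Sk(M). -/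

namespace AdequateSets

open FirstOrder Language

/-! ### Definable predicates and Skolem hulls -/

section Definable

variable {π : Iio (ω_ 2 : Ordinal.{0}) ≃ HOmegaTwo} {Y : Set (Set Ordinal.{0})} {α : Type}

/-- The predicate `P` on assignments of the variables `α` is definable in `𝒜`. -/
def IsDef (π : Iio (ω_ 2 : Ordinal.{0}) ≃ HOmegaTwo) (Y : Set (Set Ordinal.{0})) {α : Type}
    (P : (α → HOmegaTwo) → Prop) : Prop :=
  letI := structA π Y
  ∃ φ : lang.Formula α, ∀ v, φ.Realize v ↔ P v

theorem IsDef.mem (i j : α) : IsDef π Y fun v => (v i).1 ∈ (v j).1 := by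
  let _ := structA π Y
  refine ⟨Relations.formula₂ (L := lang) (r := Rel.mem) (Term.var i) (Term.var j), fun v => ?_⟩
  exact Formula.realize_rel₂.trans Iff.rfl

theorem IsDef.pi (i j : α) : IsDef π Y fun v =>
    ∃ ξ : Iio (ω_ 2 : Ordinal.{0}), (v i).1 = ξ.1.toZFSet ∧ v j = π ξ := by
  let _ := structA π Y
  refine ⟨Relations.formula₂ (L := lang) (r := Rel.pi) (Term.var i) (Term.var j), fun v => ?_⟩
  exact Formula.realize_rel₂.trans Iff.rfl

theorem IsDef.thin (i : α) : IsDef π Y fun v => ∃ a ∈ Y, Codes (v i) a := by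
  let _ := structA π Y
  refine ⟨Relations.formula₁ (L := lang) (r := Rel.thin) (Term.var i), fun v => ?_⟩
  exact Formula.realize_rel₁.trans Iff.rfl

theorem IsDef.eq (i j : α) : IsDef π Y fun v => v i = v j := by
  let _ := structA π Y
  exact ⟨Term.equal (Term.var i) (Term.var j), fun v => by simp⟩

theorem IsDef.and {P Q : (α → HOmegaTwo) → Prop} :
    IsDef π Y P → IsDef π Y Q → IsDef π Y fun v => P v ∧ Q v := by
  let _ := structA π Y
  rintro ⟨φ, hφ⟩ ⟨ψ, hψ⟩
  exact ⟨φ ⊓ ψ, fun v => by rw [Formula.realize_inf, hφ, hψ]⟩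

theorem IsDef.or {P Q : (α → HOmegaTwo) → Prop} :
    IsDef π Y P → IsDef π Y Q → IsDef π Y fun v => P v ∨ Q v := by
  let _ := structA π Y
  rintro ⟨φ, hφ⟩ ⟨ψ, hψ⟩
  exact ⟨φ ⊔ ψ, fun v => by rw [Formula.realize_sup, hφ, hψ]⟩

theorem IsDef.imp {P Q : (α → HOmegaTwo) → Prop} :
    IsDef π Y P → IsDef π Y Q → IsDef π Y fun v => P v → Q v := by
  let _ := structA π Y
  rintro ⟨φ, hφ⟩ ⟨ψ, hψ⟩
  exact ⟨φ.imp ψ, fun v => by rw [Formula.realize_imp, hφ, hψ]⟩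

theorem IsDef.iff {P Q : (α → HOmegaTwo) → Prop} (hP : IsDef π Y P) (hQ : IsDef π Y Q) :
    IsDef π Y fun v => P v ↔ Q v := by
  simp_rw [iff_iff_implies_and_implies]
  exact (hP.imp hQ).and (hQ.imp hP)

theorem IsDef.not {P : (α → HOmegaTwo) → Prop} : IsDef π Y P → IsDef π Y fun v => ¬ P v := by
  let _ := structA π Y
  rintro ⟨φ, hφ⟩
  exact ⟨φ.not, fun v => by rw [Formula.realize_not, hφ]⟩

theorem IsDef.ex {P : (α → HOmegaTwo) → HOmegaTwo → Prop} :
    IsDef π Y (fun w : Option α → HOmegaTwo => P (fun i => w (some i)) (w none)) →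
      IsDef π Y fun v => ∃ y, P v y := by
  let _ := structA π Y
  rintro ⟨φ, hφ⟩
  refine ⟨(φ.relabel fun o : Option α => o.elim (Sum.inr ()) Sum.inl).iExs Unit, fun v => ?_⟩
  rw [Formula.realize_iExs]
  simp_rw [Formula.realize_relabel, hφ]
  exact ⟨fun ⟨y, hy⟩ => ⟨y (), hy⟩, fun ⟨y, hy⟩ => ⟨fun _ => y, hy⟩⟩

theorem IsDef.all {P : (α → HOmegaTwo) → HOmegaTwo → Prop}
    (h : IsDef π Y (fun w : Option α → HOmegaTwo => P (fun i => w (some i)) (w none))) :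
    IsDef π Y fun v => ∀ y, P v y := by
  simpa only [not_exists, not_not] using (IsDef.ex (P := fun v y => ¬ P v y) h.not).not

end Definable

section Hull

variable {π : Iio (ω_ 2 : Ordinal.{0}) ≃ HOmegaTwo} {Y : Set (Set Ordinal.{0})}
  {S : Set (Σ n : ℕ, (Fin n → HOmegaTwo) → HOmegaTwo)} {B : Set HOmegaTwo}

theorem subset_Sk : B ⊆ Sk S B := fun _ hx _ hK => hK.1 hx

/-- The Tarski–Vaught property of the hull: the witness is the value of a Skolem function. Every
closure property of hulls below is an instance of this. -/
theorem exists_mem_Sk (hS : IsDefinableSkolemSet π Y S) {n : ℕ}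
    {P : (Option (Fin n) → HOmegaTwo) → Prop} (hP : IsDef π Y P) (x : Fin n → HOmegaTwo)
    (hx : ∀ i, x i ∈ Sk S B) (h : ∃ y, P fun i => i.elim y x) :
    ∃ y ∈ Sk S B, P fun i => i.elim y x := by
  obtain ⟨φ, hφ⟩ := hP
  obtain ⟨f, hf, hfx⟩ := hS.skolem n φ
  refine ⟨f x, ?_, ?_⟩
  · intro K hK
    exact hK.2 ⟨n, f⟩ hf x fun i => hx i K hK
  · rw [← hφ]
    apply hfx
    simpa only [hφ] using h

theorem exists_mem_Sk₁ (hS : IsDefinableSkolemSet π Y S) {P : HOmegaTwo → HOmegaTwo → Prop}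
    (hP : IsDef π Y fun v : Option (Fin 1) → HOmegaTwo => P (v (some 0)) (v none))
    {x : HOmegaTwo} (hx : x ∈ Sk S B) (h : ∃ y, P x y) : ∃ y ∈ Sk S B, P x y :=
  exists_mem_Sk hS hP (fun _ => x) (fun _ => hx) h

theorem exists_mem_Sk₂ (hS : IsDefinableSkolemSet π Y S)
    {P : HOmegaTwo → HOmegaTwo → HOmegaTwo → Prop}
    (hP : IsDef π Y fun v : Option (Fin 2) → HOmegaTwo => P (v (some 0)) (v (some 1)) (v none))
    {x z : HOmegaTwo} (hx : x ∈ Sk S B) (hz : z ∈ Sk S B) (h : ∃ y, P x z y) :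
    ∃ y ∈ Sk S B, P x z y :=
  exists_mem_Sk hS hP ![x, z] (by simp [Fin.forall_fin_two, hx, hz]) h

end Hull

/-! ### Elements of `H(ω₂)` -/

theorem HOmegaTwo.ext_mem {x y : HOmegaTwo} (h : ∀ z : HOmegaTwo, z.1 ∈ x.1 ↔ z.1 ∈ y.1) :
    x = y := by
  apply Subtype.ext
  ext z
  exact ⟨fun hz => (h ⟨z, x.2.mem hz⟩).1 hz, fun hz => (h ⟨z, y.2.mem hz⟩).2 hz⟩

/-- A subset of an element of `H(ω₂)` is in `H(ω₂)`. -/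
theorem exists_sep (x : HOmegaTwo) (p : HOmegaTwo → Prop) :
    ∃ y : HOmegaTwo, ∀ z : HOmegaTwo, z.1 ∈ y.1 ↔ z.1 ∈ x.1 ∧ p z := by
  refine ⟨⟨ZFSet.sep (fun z => ∃ hz : z.Hereditarily _, p ⟨z, hz⟩) x.1, ?_⟩, fun z => ?_⟩
  · rw [ZFSet.hereditarily_iff]
    refine ⟨(ZFSet.card_mono fun z hz => (ZFSet.mem_sep.1 hz).1).trans_lt x.2.self, fun z hz => ?_⟩
    exact x.2.mem (ZFSet.mem_sep.1 hz).1
  · rw [ZFSet.mem_sep]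
    exact and_congr_right fun _ => ⟨fun ⟨_, h⟩ => h, fun h => ⟨z.2, h⟩⟩

/-- The range of a countable family of elements of `H(ω₂)` is in `H(ω₂)`. -/
theorem exists_range {ι : Type} [Countable ι] (s : ι → HOmegaTwo) :
    ∃ f : HOmegaTwo, ∀ y : HOmegaTwo, y.1 ∈ f.1 ↔ ∃ i, y = s i := by
  refine ⟨⟨ZFSet.range fun i => (s i).1, ?_⟩, fun y => ?_⟩
  · rw [ZFSet.hereditarily_iff]
    constructor
    · have h := ZFSet.lift_card_range_le (f := fun i => (s i).1)
      rw [Cardinal.lift_id, Cardinal.lift_id] at h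
      refine (h.trans Cardinal.mk_le_aleph0).trans_lt ?_
      rw [← Cardinal.aleph_zero]
      exact Cardinal.aleph_lt_aleph.2 (by norm_num)
    · intro y hy
      obtain ⟨i, rfl⟩ := ZFSet.mem_range.1 hy
      exact (s i).2
  · rw [ZFSet.mem_range]
    exact ⟨fun ⟨i, h⟩ => ⟨i, Subtype.ext h.symm⟩, fun ⟨i, h⟩ => ⟨i, by rw [h]⟩⟩

theorem exists_pair (x y : HOmegaTwo) :
    ∃ p : HOmegaTwo, ∀ z : HOmegaTwo, z.1 ∈ p.1 ↔ z = x ∨ z = y := by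
  obtain ⟨p, hp⟩ := exists_range fun b : Bool => if b then x else y
  exact ⟨p, fun z => by simp [hp, or_comm]⟩

theorem toZFSet_hereditarily {α : Ordinal.{0}} (hα : α < ω_ 2) :
    α.toZFSet.Hereditarily (fun y => y.card < ℵ_ 2) := by
  induction α using WellFoundedLT.induction with
  | ind α ih =>
    rw [ZFSet.hereditarily_iff]
    constructor
    · rw [Ordinal.card_toZFSet, ← Cardinal.lt_ord, Cardinal.ord_aleph]
      exact hα
    · intro y hy
      obtain ⟨β, hβ, rfl⟩ := Ordinal.mem_toZFSet_iff.1 hy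
      exact ih β hβ (hβ.trans hα)

/-- The ordinal `α < ω₂` as an element of `H(ω₂)`. -/
noncomputable def ordH (α : Ordinal.{0}) (hα : α < ω_ 2) : HOmegaTwo :=
  ⟨α.toZFSet, toZFSet_hereditarily hα⟩

theorem mem_ordPart {B : Set HOmegaTwo} {α : Ordinal.{0}} (hα : α < ω_ 2) :
    α ∈ ordPart B ↔ ordH α hα ∈ B := by
  constructor
  · rintro ⟨_, x, hx, h⟩
    rwa [show ordH α hα = x from Subtype.ext h.symm]
  · intro h
    exact ⟨hα, _, h, rfl⟩

theorem Codes.mem_iff {x : HOmegaTwo} {a : Set Ordinal.{0}} (h : Codes x a) {z : ZFSet.{0}} :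
    z ∈ x.1 ↔ ∃ α ∈ a, α.toZFSet = z :=
  Set.ext_iff.1 h z

theorem Codes.toZFSet_mem_iff {x : HOmegaTwo} {a : Set Ordinal.{0}} (h : Codes x a)
    {α : Ordinal.{0}} : α.toZFSet ∈ x.1 ↔ α ∈ a := by
  rw [h.mem_iff]
  exact ⟨fun ⟨β, hβ, e⟩ => Ordinal.toZFSet_injective e ▸ hβ, fun h => ⟨α, h, rfl⟩⟩

theorem Codes.subset {x : HOmegaTwo} {a : Set Ordinal.{0}} (h : Codes x a) : a ⊆ Iio (ω_ 2) := by
  intro α hα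
  have hx := (x.2.mem (h.toZFSet_mem_iff.2 hα)).self
  rw [Ordinal.card_toZFSet, ← Cardinal.lt_ord, Cardinal.ord_aleph] at hx
  exact hx

theorem Codes.unique {x y : HOmegaTwo} {a : Set Ordinal.{0}} (h : Codes x a) (h' : Codes y a) :
    x = y :=
  HOmegaTwo.ext_mem fun z => by rw [h.mem_iff, h'.mem_iff]

/-! ### Closure properties of Skolem hulls -/

section HullClosure

variable {π : Iio (ω_ 2 : Ordinal.{0}) ≃ HOmegaTwo} {Y : Set (Set Ordinal.{0})}
  {S : Set (Σ n : ℕ, (Fin n → HOmegaTwo) → HOmegaTwo)} {B : Set HOmegaTwo}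

/-- `f` codes an enumeration of `x` by iterated unordered pairs starting at `x`. -/
def EnumeratesBy (x f : HOmegaTwo) : Prop :=
  (∀ s : HOmegaTwo, s.1 ∈ f.1 → s = x ∨
    ∃ s' : HOmegaTwo, s'.1 ∈ f.1 ∧ ∃ v : HOmegaTwo, ∀ z : HOmegaTwo, z.1 ∈ s.1 ↔ z = s' ∨ z = v) ∧
  (∀ s' s t : HOmegaTwo, s'.1 ∈ f.1 → s.1 ∈ f.1 → t.1 ∈ f.1 → s'.1 ∈ s.1 → s'.1 ∈ t.1 → s = t) ∧
  ∀ v : HOmegaTwo, v.1 ∈ x.1 → ∃ s : HOmegaTwo, s.1 ∈ f.1 ∧ s ≠ x ∧ v.1 ∈ s.1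

theorem isDef_enumeratesBy {α : Type} (i j : α) :
    IsDef π Y fun v : α → HOmegaTwo => EnumeratesBy (v i) (v j) := by
  unfold EnumeratesBy
  repeat' first
    | exact IsDef.mem _ _
    | exact IsDef.eq _ _
    | apply IsDef.and
    | apply IsDef.or
    | apply IsDef.iff
    | apply IsDef.ex
    | apply IsDef.all
    | apply IsDef.not
    | apply IsDef.imp

/-- The witness is {s₀, s₁, …} with s₀ = x and sₙ₊₁ = {sₙ, e n}. Ranks strictly increase, so no sₙ
is an element of x, and sₖ ∈ sₘ forces m = k + 1. This replaces a function on ω, so neither ω nor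
ordered pairs need be defined in 𝒜. -/
theorem exists_enumeratesBy (x : HOmegaTwo) (e : ℕ → HOmegaTwo)
    (he : ∀ z : HOmegaTwo, z.1 ∈ x.1 ↔ ∃ n, z = e n) : ∃ f, EnumeratesBy x f := by
  choose pair hpair using exists_pair
  let s : ℕ → HOmegaTwo := fun n => Nat.rec x (fun k t => pair t (e k)) n
  have hs0 : s 0 = x := rfl
  have hs : ∀ n (z : HOmegaTwo), z.1 ∈ (s (n + 1)).1 ↔ z = s n ∨ z = e n := fun n => hpair _ _
  have hmono : StrictMono fun n => (s n).1.rank :=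
    strictMono_nat_of_lt_succ fun n => ZFSet.rank_lt_of_mem ((hs n _).2 (Or.inl rfl))
  have hnot : ∀ k, (s k).1 ∉ x.1 := fun k hk =>
    (ZFSet.rank_lt_of_mem hk).not_ge (hmono.monotone (Nat.zero_le k))
  have hmem : ∀ k m, (s k).1 ∈ (s m).1 → m = k + 1 := by
    intro k m h
    cases m with
    | zero => exact (hnot k h).elim
    | succ m =>
      obtain h | h := (hs m _).1 h
      · rw [hmono.injective (congrArg (fun t : HOmegaTwo => t.1.rank) h)]
      · exact (hnot k ((he _).2 ⟨m, h⟩)).elim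
  obtain ⟨f, hf⟩ := exists_range s
  refine ⟨f, ?_, ?_, ?_⟩
  · intro t ht
    obtain ⟨n, rfl⟩ := (hf t).1 ht
    cases n with
    | zero => exact Or.inl rfl
    | succ n => exact Or.inr ⟨s n, (hf _).2 ⟨n, rfl⟩, e n, hs n⟩
  · intro r t u hr ht hu hrt hru
    obtain ⟨k, rfl⟩ := (hf r).1 hr
    obtain ⟨m, rfl⟩ := (hf t).1 ht
    obtain ⟨l, rfl⟩ := (hf u).1 hu
    rw [hmem k m hrt, hmem k l hru]
  · intro v hv
    obtain ⟨n, rfl⟩ := (he v).1 hv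
    refine ⟨s (n + 1), (hf _).2 ⟨n + 1, rfl⟩, fun h => ?_, (hs n _).2 (Or.inr rfl)⟩
    exact (hmono (Nat.succ_pos n)).ne' (congrArg (fun t : HOmegaTwo => t.1.rank) h)

/-- The elements of an unordered pair in a Skolem hull belong to the hull, given that one does. -/
theorem mem_Sk_of_pair (hS : IsDefinableSkolemSet π Y S) {s u v : HOmegaTwo} (hs : s ∈ Sk S B)
    (hu : u ∈ Sk S B) (h : ∀ z : HOmegaTwo, z.1 ∈ s.1 ↔ z = u ∨ z = v) : v ∈ Sk S B := by
  by_cases huv : v = u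
  · rwa [huv]
  obtain ⟨y, hy, hys, hyu⟩ := exists_mem_Sk₂ hS
    (P := fun s u y => y.1 ∈ s.1 ∧ ¬ y = u) ((IsDef.mem _ _).and (IsDef.eq _ _).not) hs hu
    ⟨v, (h v).2 (Or.inr rfl), huv⟩
  rwa [← ((h y).1 hys).resolve_left hyu]

/-- Every element of a countable element of a Skolem hull belongs to the hull. -/
theorem mem_Sk_of_mem_countable (hS : IsDefinableSkolemSet π Y S) {x : HOmegaTwo}
    (hx : x ∈ Sk S B) (hc : {z : HOmegaTwo | z.1 ∈ x.1}.Countable) {z : HOmegaTwo}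
    (hz : z.1 ∈ x.1) : z ∈ Sk S B := by
  obtain ⟨e, he⟩ := hc.exists_eq_range ⟨z, hz⟩
  have he' : ∀ z : HOmegaTwo, z.1 ∈ x.1 ↔ ∃ n, z = e n := fun z =>
    (Set.ext_iff.1 he z).trans (exists_congr fun _ => eq_comm)
  obtain ⟨f, hfK, hA, hB, hC⟩ := exists_mem_Sk₁ hS (isDef_enumeratesBy _ _) hx
    (exists_enumeratesBy x e he')
  -- Every member of f is in the hull, by induction on rank: x is, and any other s is the unique
  -- member of f containing its predecessor s'.
  have key : ∀ o : Ordinal.{0}, ∀ s : HOmegaTwo, s.1.rank = o → s.1 ∈ f.1 → s ∈ Sk S B := by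
    intro o
    induction o using WellFoundedLT.induction with
    | ind o ih =>
      rintro s rfl hs
      obtain rfl | ⟨s', hs', v, hv⟩ := hA s hs
      · exact hx
      have hs's : s'.1 ∈ s.1 := (hv s').2 (Or.inl rfl)
      have hs'K := ih _ (ZFSet.rank_lt_of_mem hs's) s' rfl hs'
      obtain ⟨y, hy, hyf, hys⟩ := exists_mem_Sk₂ hS (P := fun f s' y => y.1 ∈ f.1 ∧ s'.1 ∈ y.1)
        ((IsDef.mem _ _).and (IsDef.mem _ _)) hfK hs'K ⟨s, hs, hs's⟩
      rwa [hB s' s y hs' hs hyf hs's hys]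
  obtain ⟨s, hs, hsx, hzs⟩ := hC z hz
  obtain h | ⟨s', hs', v, hv⟩ := hA s hs
  · exact (hsx h).elim
  obtain rfl | rfl := (hv z).1 hzs
  · exact key _ _ rfl hs'
  · exact mem_Sk_of_pair hS (key _ _ rfl hs) (key _ _ rfl hs') hv

theorem Codes.countable {x : HOmegaTwo} {a : Set Ordinal.{0}} (h : Codes x a) (ha : a.Countable) :
    {z : HOmegaTwo | z.1 ∈ x.1}.Countable := by
  refine Set.MapsTo.countable_of_injOn (f := Subtype.val) (t := Ordinal.toZFSet '' a) ?_
    Subtype.val_injective.injOn (ha.image _)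
  exact fun z hz => h.mem_iff.1 hz

/-- A countable set of ordinals in `Sk(N)` is included in `Sk(N) ∩ ω₂`. -/
theorem Codes.subset_ordPart (hS : IsDefinableSkolemSet π Y S) {x : HOmegaTwo}
    {a : Set Ordinal.{0}} (h : Codes x a) (ha : a.Countable) (hx : x ∈ Sk S B) :
    a ⊆ ordPart (Sk S B) := by
  intro α hα
  rw [mem_ordPart (h.subset hα)]
  exact mem_Sk_of_mem_countable hS hx (h.countable ha) (h.toZFSet_mem_iff.2 hα)

theorem memH_inter_Iio (hS : IsDefinableSkolemSet π Y S) {a : Set Ordinal.{0}} {δ : Ordinal.{0}}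
    (ha : MemH a (Sk S B)) (hδ : δ ∈ ordPart (Sk S B)) : MemH (a ∩ Iio δ) (Sk S B) := by
  obtain ⟨x, hx, hxa⟩ := ha
  have hδ' := hδ.1
  rw [mem_ordPart hδ'] at hδ
  obtain ⟨y, hy, h⟩ := exists_mem_Sk₂ hS
    (P := fun x d y => ∀ z : HOmegaTwo, z.1 ∈ y.1 ↔ z.1 ∈ x.1 ∧ z.1 ∈ d.1)
    (IsDef.all ((IsDef.mem _ _).iff ((IsDef.mem _ _).and (IsDef.mem _ _)))) hx hδ
    (exists_sep x _)
  refine ⟨y, hy, ?_⟩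
  ext z
  constructor
  · intro hz
    obtain ⟨hzx, hzd⟩ := (h ⟨z, y.2.mem hz⟩).1 hz
    obtain ⟨α, hα, rfl⟩ := hxa.mem_iff.1 hzx
    exact ⟨α, ⟨hα, Ordinal.toZFSet_mem_toZFSet_iff.1 hzd⟩, rfl⟩
  · rintro ⟨α, ⟨hα, hαδ⟩, rfl⟩
    exact (h (ordH α (hxa.subset hα))).2
      ⟨hxa.toZFSet_mem_iff.2 hα, Ordinal.toZFSet_mem_toZFSet_iff.2 hαδ⟩

/-- If a countable set of ordinals is in `Sk(N)`, so are its initial segments. -/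
theorem memH_initialSegment (hS : IsDefinableSkolemSet π Y S) {a : Set Ordinal.{0}}
    (hc : a.Countable) (ha : MemH a (Sk S B)) (γ : Ordinal.{0}) : MemH (a ∩ Iio γ) (Sk S B) := by
  have hsub : a ⊆ ordPart (Sk S B) := by
    obtain ⟨x, hx, hxa⟩ := ha
    exact hxa.subset_ordPart hS hc hx
  -- γ need not be in the hull. Since a is included in the hull, cutting at γ is the same as cutting
  -- at the least hull ordinal δ ≥ γ, or not cutting at all if there is none.
  by_cases h : ∃ δ ∈ ordPart (Sk S B), γ ≤ δ
  · obtain ⟨δ, ⟨hδ, hγδ⟩, hmin⟩ := WellFounded.has_min (r := ((· < ·) : Ordinal → Ordinal → Prop))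
      wellFounded_lt {δ | δ ∈ ordPart (Sk S B) ∧ γ ≤ δ} h
    have : a ∩ Iio γ = a ∩ Iio δ := by
      ext α
      refine and_congr_right fun hα => ⟨fun h => lt_of_lt_of_le h hγδ, fun h => ?_⟩
      by_contra hlt
      exact hmin α ⟨hsub hα, not_lt.1 hlt⟩ h
    rw [this]
    exact memH_inter_Iio hS ha hδ
  · push Not at h
    rwa [show a ∩ Iio γ = a from inter_eq_left.2 fun α hα => h α (hsub hα)]

/-- If `a ∈ Sk(N)` then the index of `a` under `π` is in `Sk(N)`. -/
theorem symm_mem_ordPart (hS : IsDefinableSkolemSet π Y S) {x : HOmegaTwo} (hx : x ∈ Sk S B) :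
    (π.symm x).1 ∈ ordPart (Sk S B) := by
  obtain ⟨y, hy, ξ, hyξ, hξ⟩ := exists_mem_Sk₁ hS
    (P := fun x y => ∃ ξ : Iio (ω_ 2 : Ordinal.{0}), y.1 = ξ.1.toZFSet ∧ x = π ξ)
    (IsDef.pi _ _) hx ⟨ordH _ (π.symm x).2, π.symm x, rfl, by simp⟩
  refine ⟨(π.symm x).2, y, hy, ?_⟩
  rw [hyξ, hξ, Equiv.symm_apply_apply]

theorem apply_mem_Sk (hS : IsDefinableSkolemSet π Y S) {ξ : Iio (ω_ 2 : Ordinal.{0})}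
    (hξ : ξ.1 ∈ ordPart (Sk S B)) : π ξ ∈ Sk S B := by
  rw [mem_ordPart ξ.2] at hξ
  obtain ⟨y, hy, ξ', hξ', rfl⟩ := exists_mem_Sk₁ hS
    (P := fun x y => ∃ ξ : Iio (ω_ 2 : Ordinal.{0}), x.1 = ξ.1.toZFSet ∧ y = π ξ)
    (IsDef.pi _ _) hξ ⟨π ξ, ξ, rfl, rfl⟩
  rwa [show ξ = ξ' from Subtype.ext (Ordinal.toZFSet_injective hξ')]

/-- The lift is needed because sets of ordinals have their cardinalities one universe up. -/
theorem cof_lift_omega_two : (Ordinal.lift.{1} (ω_ 2 : Ordinal.{0})).cof = ℵ_ 2 := by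
  have h := Cardinal.cof_omega_add_one.{0} 1
  rw [one_add_one_eq_two] at h
  rw [← Ordinal.lift_cof, h, Cardinal.lift_aleph, Ordinal.lift_ofNat]

theorem lt_sSup_add_one {s : Set Ordinal.{0}} {β : Ordinal.{0}} (h : s ⊆ Iio β) {α : Ordinal.{0}}
    (hα : α ∈ s) : α < sSup ((· + 1) '' s) := by
  refine (Order.lt_add_one_iff.2 le_rfl).trans_le (le_csSup ⟨β, ?_⟩ ⟨α, hα, rfl⟩)
  rintro _ ⟨ξ, hξ, rfl⟩
  exact Order.add_one_le_of_lt (h hξ)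

/-- A set of at most `ℵ₁` ordinals below `ω₂` is strictly bounded below `ω₂`. -/
theorem exists_bound_lt_omega_two {s : Set Ordinal.{0}} (hs : #s ≤ ℵ_ 1) (h : s ⊆ Iio (ω_ 2)) :
    ∃ γ < ω_ 2, ∀ α ∈ s, α < γ := by
  refine ⟨sSup ((· + 1) '' s), Ordinal.sSup_add_one_lt_of_lt_cof ?_ h, fun α hα => ?_⟩
  · rw [cof_lift_omega_two]
    exact hs.trans_lt (Cardinal.aleph_lt_aleph.2 (by norm_num))
  · exact lt_sSup_add_one h hα

/-- A countable subset of an ordinal of cofinality `ω₁` is strictly bounded. -/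
theorem exists_bound_of_cof {a : Set Ordinal.{0}} {β : Ordinal.{0}} (hβ : β.cof = ℵ_ 1)
    (ha : a.Countable) (h : a ⊆ Iio β) : ∃ γ < β, ∀ α ∈ a, α < γ := by
  refine ⟨sSup ((· + 1) '' a), Ordinal.sSup_add_one_lt_of_lt_cof ?_ h, fun α hα =>
    lt_sSup_add_one h hα⟩
  rw [← Ordinal.lift_cof, hβ, Cardinal.lift_aleph, Ordinal.lift_one]
  refine (Cardinal.le_aleph0_iff_set_countable.2 ha).trans_lt ?_
  rw [← Cardinal.aleph_zero]
  exact Cardinal.aleph_lt_aleph.2 zero_lt_one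

/-- If `β ∈ Λ` and `a ∈ Y` is bounded in `β`, then the index of `a` under `π` is below `β`. -/
theorem symm_lt_of_codes (hS : IsDefinableSkolemSet π Y S) (hY : IsThin Y)
    {β η : Ordinal.{0}} (hβ : β ∈ Lam S) (hη : η < β) {a : Set Ordinal.{0}} (ha : a ∈ Y)
    (haη : a ⊆ Iio η) {x : HOmegaTwo} (hx : Codes x a) : (π.symm x).1 < β := by
  obtain ⟨δ, ⟨hδ, hδC⟩, hηδ, hδβ⟩ := hβ.2.2 η hη
  have hη2 := hη.trans hβ.1
  have hηK : ordH η hη2 ∈ Sk S (toH (Iio δ)) := subset_Sk ⟨η, hηδ, rfl⟩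
  -- `P e d`: d is an ordinal below ω₂ (it has a value under π) and bounds the indices of all
  -- members of Y included in e. A hull closed at δ ∈ C must contain such a bound for η, which is
  -- then below δ.
  let P : HOmegaTwo → HOmegaTwo → Prop := fun e d =>
    (∃ y : HOmegaTwo, ∃ ξ : Iio (ω_ 2 : Ordinal.{0}), d.1 = ξ.1.toZFSet ∧ y = π ξ) ∧
    ∀ b : HOmegaTwo, (∃ a ∈ Y, Codes b a) → (∀ z : HOmegaTwo, z.1 ∈ b.1 → z.1 ∈ e.1) →
      ∃ i : HOmegaTwo, i.1 ∈ d.1 ∧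
        ∃ ξ : Iio (ω_ 2 : Ordinal.{0}), i.1 = ξ.1.toZFSet ∧ b = π ξ
  have hP : IsDef π Y fun v : Option (Fin 1) → HOmegaTwo => P (v (some 0)) (v none) :=
    (IsDef.ex (IsDef.pi _ _)).and (IsDef.all ((IsDef.thin _).imp ((IsDef.all ((IsDef.mem _ _).imp
      (IsDef.mem _ _))).imp (IsDef.ex ((IsDef.mem _ _).and (IsDef.pi _ _))))))
  obtain ⟨d, hd, ⟨-, ζ, hdζ, -⟩, hall⟩ := exists_mem_Sk₁ hS hP hηK (by
    let s : Set Ordinal.{0} := {ξ | ∃ b : HOmegaTwo, ξ = (π.symm b).1 ∧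
      ∃ a ∈ Y, Codes b a ∧ a ⊆ Iio η}
    have hs : #s ≤ ℵ_ 1 := by
      -- A subset of η is its own trace on η, so thinness counts these sets; codes being unique, it
      -- also counts their indices.
      have hsub : {a | ∃ b : HOmegaTwo, a ∈ Y ∧ Codes b a ∧ a ⊆ Iio η} ⊆
          (fun a : Set Ordinal.{0} => a ∩ Iio η) '' Y :=
        fun a ⟨_, ha, _, haη⟩ => ⟨a, ha, inter_eq_left.2 haη⟩
      refine (Cardinal.mk_le_of_surjective (f := fun a : {a : Set Ordinal.{0} |
        ∃ b : HOmegaTwo, a ∈ Y ∧ Codes b a ∧ a ⊆ Iio η} => (⟨(π.symm a.2.choose).1, _, rfl, a.1,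
          a.2.choose_spec⟩ : s)) ?_).trans ((Cardinal.mk_le_mk_of_subset hsub).trans (hY η hη2))
      rintro ⟨_, b, rfl, a, ha⟩
      refine ⟨⟨a, b, ha⟩, Subtype.ext ?_⟩
      have h : ∃ b : HOmegaTwo, a ∈ Y ∧ Codes b a ∧ a ⊆ Iio η := ⟨b, ha⟩
      change (π.symm h.choose).1 = _
      rw [h.choose_spec.2.1.unique ha.2.1]
    obtain ⟨γ, hγ, hsγ⟩ := exists_bound_lt_omega_two hs
      (by rintro _ ⟨b, rfl, -⟩; exact (π.symm b).2)
    refine ⟨ordH γ hγ, ⟨π ⟨γ, hγ⟩, ⟨γ, hγ⟩, rfl, rfl⟩, ?_⟩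
    rintro b ⟨a, ha, hba⟩ hb
    refine ⟨ordH _ (π.symm b).2, Ordinal.toZFSet_mem_toZFSet_iff.2 (hsγ _ ⟨b, rfl, a, ha, hba, ?_⟩),
      π.symm b, rfl, by simp⟩
    intro α hα
    exact Ordinal.toZFSet_mem_toZFSet_iff.1
      (hb (ordH α (hba.subset hα)) (hba.toZFSet_mem_iff.2 hα)))
  have hζ : ζ.1 < δ := by
    rw [← mem_Iio, ← hδC]
    exact ⟨ζ.2, d, hd, hdζ⟩
  obtain ⟨i, hid, ξ, hiξ, hxξ⟩ := hall x ⟨a, ha, hx⟩ (by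
    intro z hz
    obtain ⟨α, hα, e⟩ := hx.mem_iff.1 hz
    rw [← e]
    exact Ordinal.toZFSet_mem_toZFSet_iff.2 (haη hα))
  rw [hdζ, hiξ, Ordinal.toZFSet_mem_toZFSet_iff] at hid
  rw [hxξ, Equiv.symm_apply_apply]
  exact hid.trans (hζ.trans hδβ)

end HullClosure

/-! ### Comparison points -/

section Comparison

variable {π : Iio (ω_ 2 : Ordinal.{0}) ≃ HOmegaTwo} {Y : Set (Set Ordinal.{0})}
  {S : Set (Σ n : ℕ, (Fin n → HOmegaTwo) → HOmegaTwo)} {Γ M M' N : Set Ordinal.{0}}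
  {β β' : Ordinal.{0}}

theorem comparisonPoint_comm (Γ M N : Set Ordinal.{0}) :
    comparisonPoint Γ M N = comparisonPoint Γ N M := by
  rw [comparisonPoint, comparisonPoint, inter_comm]

/-- Here sup(M ∩ γ) ≤ β, so β competes in the minimum that defines γ. -/
theorem le_of_mem_gammaSet (hβ : β ∈ Γ) {γ : Ordinal.{0}} (h : M ∩ Iio γ ⊆ Iio β)
    (hγ : γ ∈ gammaSet Γ M) : γ ≤ β :=
  hγ.2.2 ⟨hβ, csSup_le' fun _ hα => (h hα).le⟩

/-- Comparison points of `M` and `N` are comparison points of `M'` and `N`, if `N ⊆ β` and the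
initial segments of `M` up to `β` and of `M'` up to `β'` coincide. -/
theorem gammaSet_inter_transfer (hβ : β ∈ Γ) (hβ' : β' ∈ Γ)
    (hM : M ∩ Iio β = M' ∩ Iio β') (hN : N ⊆ Iio β) {γ : Ordinal.{0}}
    (hγ : γ ∈ gammaSet Γ M ∩ gammaSet Γ N) :
    γ ≤ β' ∧ γ ∈ gammaSet Γ M' ∩ gammaSet Γ N := by
  have h1 : γ ≤ β := le_of_mem_gammaSet hβ (inter_subset_left.trans hN) hγ.2
  have h2 : γ ≤ β' := le_of_mem_gammaSet hβ'
    ((inter_subset_inter_right M (Iio_subset_Iio h1)).trans (hM.subset.trans inter_subset_right))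
    hγ.1
  refine ⟨h2, ?_, hγ.2⟩
  have h3 : M ∩ Iio γ = M' ∩ Iio γ := by
    rw [← inter_eq_right.2 (Iio_subset_Iio h1), ← inter_assoc, hM, inter_assoc,
      inter_eq_right.2 (Iio_subset_Iio h2), inter_eq_right.2 (Iio_subset_Iio h1)]
  have h4 := hγ.1
  rw [gammaSet, mem_ofPred_eq, h3] at h4
  exact h4

/-- The relation required of the members of an adequate set, at the point `γ`. -/
def ComparableAt (S : Set (Σ n : ℕ, (Fin n → HOmegaTwo) → HOmegaTwo)) (M N : Set Ordinal.{0})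
    (γ : Ordinal.{0}) : Prop :=
  M ∩ Iio γ = N ∩ Iio γ ∨ MemH (M ∩ Iio γ) (Sk S (toH N)) ∨ MemH (N ∩ Iio γ) (Sk S (toH M))

theorem ComparableAt.symm {γ : Ordinal.{0}} (h : ComparableAt S M N γ) : ComparableAt S N M γ :=
  h.imp Eq.symm Or.symm

theorem ComparableAt.mono (hS : IsDefinableSkolemSet π Y S) (hM : M.Countable) (hN : N.Countable)
    {γ ζ : Ordinal.{0}} (hγ : γ ≤ ζ) (h : ComparableAt S M N ζ) : ComparableAt S M N γ := by
  have key : ∀ a : Set Ordinal.{0}, a ∩ Iio γ = a ∩ Iio ζ ∩ Iio γ := fun a => by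
    rw [inter_assoc, inter_eq_right.2 (Iio_subset_Iio hγ)]
  unfold ComparableAt
  rw [key M, key N]
  refine h.imp (fun h => by rw [h]) (Or.imp (fun h => ?_) fun h => ?_)
  · exact memH_initialSegment hS (hM.mono inter_subset_left) h γ
  · exact memH_initialSegment hS (hN.mono inter_subset_left) h γ

/-- The amalgamation step: M' is the copy of M in the lower condition, which already contains N. -/
theorem comparableAt_comparisonPoint (hS : IsDefinableSkolemSet π Y S)
    (hYc : Y ⊆ countableSubsets) (hY : IsThin Y) (hYi : InitialSegmentClosed Y)
    (hΓ : Γ ⊆ Lam S) (hβ : β ∈ Γ) (hβ' : β' ∈ Γ) (hle : β' ≤ β)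
    (hM : M ∈ models Y S) (hM' : M' ∈ models Y S) (hN : N ∈ models Y S)
    (hMM' : M ∩ Iio β = M' ∩ Iio β') (hNβ : N ⊆ Iio β)
    (h : ComparableAt S M' N (comparisonPoint Γ M' N)) :
    ComparableAt S M N (comparisonPoint Γ M N) := by
  set γ := comparisonPoint Γ M N with hγdef
  have hγ : γ ≤ β' := csSup_le' fun δ hδ =>
    (gammaSet_inter_transfer hβ hβ' hMM' hNβ hδ).1
  have hγζ : γ ≤ comparisonPoint Γ M' N := csSup_le_csSup'
    ⟨ω_ 2, fun δ hδ => (hΓ hδ.1.1).1.le⟩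
    fun δ hδ => (gammaSet_inter_transfer hβ hβ' hMM' hNβ hδ).2
  have hMβ' : M ∩ Iio β' = M' ∩ Iio β' := by
    rw [← inter_eq_right.2 (Iio_subset_Iio hle), ← inter_assoc, hMM', inter_assoc, inter_self]
    rw [inter_eq_right.2 (Iio_subset_Iio hle)]
  have hMγ : M ∩ Iio γ = M' ∩ Iio γ := by
    rw [← inter_eq_right.2 (Iio_subset_Iio hγ), ← inter_assoc, hMβ', inter_assoc]
  have hNY : N ∩ Iio γ ∈ Y := hYi N hN.1 γ (hγ.trans_lt (hΓ hβ').1)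
  obtain ⟨η, hη, hNη⟩ := exists_bound_of_cof (hΓ hβ').2.1 (hYc hNY).2
    (inter_subset_right.trans (Iio_subset_Iio hγ))
  obtain h | h | ⟨x, hx, hxN⟩ := h.mono hS (hYc hM'.1).2 (hYc hN.1).2 hγζ
  · exact Or.inl (hMγ.trans h)
  · exact Or.inr (Or.inl (hMγ ▸ h))
  -- Only the part of M' below β' is shared with M, so the set is moved through its index, which
  -- lies there.
  · have hlt : (π.symm x).1 < β' := symm_lt_of_codes hS hY (hΓ hβ') hη hNY hNη hxN
    have hmem : (π.symm x).1 ∈ M' := hM'.2.1 ▸ symm_mem_ordPart hS hx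
    have hmem' : (π.symm x).1 ∈ M := (hMβ'.symm.subset ⟨hmem, hlt⟩).1
    refine Or.inr (Or.inr ⟨x, ?_, hxN⟩)
    rw [← π.apply_symm_apply x]
    apply apply_mem_Sk hS
    rwa [hM.2.1]

end Comparison

/-! ### A pressing-down argument -/

/-- The ordinals closed under a function on `ω₂` form a club. -/
theorem isClub_closurePoints (k : Iio (ω_ 2 : Ordinal.{0}) → Iio (ω_ 2 : Ordinal.{0})) :
    IsClub {β | ∀ η < β, k η < β} := by
  constructor
  · intro t ht _ _ β hβ η hη
    obtain ⟨τ, hτ, hητ⟩ := (lt_isLUB_iff hβ).1 hη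
    exact (ht hτ η hητ).trans_le (hβ.1 hτ)
  · intro a
    have step : ∀ b : Iio (ω_ 2 : Ordinal.{0}), ∃ c : Iio (ω_ 2 : Ordinal.{0}),
        b < c ∧ ∀ η ≤ b, k η < c := by
      intro b
      -- Taking the maximum with η makes the bound exceed b itself as well as the values of k.
      have hb : #((fun η => (max (k η) η).1) '' Iic b) ≤ ℵ_ 1 := by
        have h : #(Iic b) ≤ #(Iio (b.1 + 1)) := Cardinal.mk_le_of_injective
          (f := fun η => ⟨η.1.1, mem_Iio.2 (Order.lt_add_one_iff.2 (mem_Iic.1 η.2))⟩)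
          fun η η' h => Subtype.ext (Subtype.ext (Subtype.mk.inj h))
        refine Cardinal.mk_image_le.trans (h.trans ?_)
        have hb1 : (b.1 + 1).card < ℵ_ 2 := by
          rw [← Cardinal.lt_ord, Cardinal.ord_aleph]
          exact (Cardinal.isSuccLimit_omega 2).add_one_lt b.2
        have h2 : ℵ_ 2 = Order.succ (ℵ_ 1) := by
          rw [← one_add_one_eq_two, Cardinal.succ_aleph]
        rw [h2, Order.lt_succ_iff] at hb1
        have hb1' := Cardinal.lift_le.{1}.2 hb1
        rwa [Cardinal.lift_aleph, Ordinal.lift_one, ← Cardinal.mk_Iio_ordinal] at hb1'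
      obtain ⟨γ, hγ, h⟩ := exists_bound_lt_omega_two hb (by
        rintro _ ⟨η, -, rfl⟩
        exact (max (k η) η).2)
      exact ⟨⟨γ, hγ⟩, (le_max_right (k b) b).trans_lt (h _ ⟨b, mem_Iic.2 le_rfl, rfl⟩),
        fun η hη => (le_max_left (k η) η).trans_lt (h _ ⟨η, hη, rfl⟩)⟩
    choose next hlt hk using step
    let b : ℕ → Iio (ω_ 2 : Ordinal.{0}) := fun n => Nat.rec a (fun _ c => next c) n
    obtain ⟨γ, hγ, hb⟩ := exists_bound_lt_omega_two (s := range fun n => (b n).1)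
      (by
        refine (Cardinal.le_aleph0_iff_set_countable.2 (countable_range _)).trans ?_
        exact Cardinal.aleph0_le_aleph 1)
      (by rintro _ ⟨n, rfl⟩; exact (b n).2)
    have hbdd : BddAbove (range fun n => (b n).1) := ⟨γ, fun α hα => (hb α hα).le⟩
    have hsup : (⨆ n, (b n).1) < ω_ 2 := (ciSup_le' fun n => (hb _ ⟨n, rfl⟩).le).trans_lt hγ
    refine ⟨⟨⨆ n, (b n).1, hsup⟩, fun η hη => ?_, le_ciSup hbdd 0⟩
    obtain ⟨n, hn⟩ := exists_lt_of_lt_ciSup (show η.1 < ⨆ n, (b n).1 from hη)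
    exact (hk (b n) η (le_of_lt hn)).trans_le (le_ciSup hbdd (n + 1))

/-- If `T` is defined on a stationary set and `T β` lies in one of `ℵ₁` many sets attached to some
`η < β`, then `T` is constant on an unbounded set. -/
theorem exists_unbounded_fiber {σ : Type 1} {Γ : Set Ordinal.{0}}
    (hΓ : IsStationary {β : Iio (ω_ 2 : Ordinal.{0}) | (β : Ordinal.{0}) ∈ Γ})
    (T : Ordinal.{0} → σ) (F : Ordinal.{0} → Set σ) (hF : ∀ η < ω_ 2, #(F η) ≤ ℵ_ 1)
    (hT : ∀ β ∈ Γ, β < ω_ 2 → ∃ η < β, T β ∈ F η) :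
    ∃ t, ∀ γ < ω_ 2, ∃ β ∈ Γ, β < ω_ 2 ∧ γ < β ∧ T β = t := by
  -- Otherwise each t has a bound `h t` past which T avoids it, and `k η` dominates `h` on `F η`. A
  -- β ∈ Γ closed under k has T β ∈ F η for some η < β, so it lies past `h (T β)`.
  by_contra! hcon
  choose h hh hbound using hcon
  have hk : ∀ η : Iio (ω_ 2 : Ordinal.{0}), ∃ γ : Iio (ω_ 2 : Ordinal.{0}),
      ∀ t ∈ F η, h t < γ.1 := by
    intro η
    obtain ⟨γ, hγ, hs⟩ := exists_bound_lt_omega_two (s := h '' F η)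
      (Cardinal.mk_image_le.trans (hF η η.2)) (by rintro _ ⟨t, -, rfl⟩; exact hh t)
    exact ⟨⟨γ, hγ⟩, fun t ht => hs _ ⟨t, ht, rfl⟩⟩
  choose k hk using hk
  obtain ⟨β, hβ, hβk⟩ := hΓ (isClub_closurePoints k)
  obtain ⟨η, hη, hTη⟩ := hT β hβ β.2
  have hη2 : η < ω_ 2 := hη.trans β.2
  exact hbound (T β) β hβ β.2 ((hk ⟨η, hη2⟩ _ hTη).trans (hβk ⟨η, hη2⟩ hη)) rfl

theorem mk_finite_subsets_le {σ : Type 1} {A : Set σ} (hA : #A ≤ ℵ_ 1) :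
    #{t : Set σ | t.Finite ∧ t ⊆ A} ≤ ℵ_ 1 := by
  have h : #(List A) ≤ ℵ_ 1 :=
    (Cardinal.mk_list_le_max A).trans (max_le (Cardinal.aleph0_le_aleph 1) hA)
  refine (Cardinal.mk_le_of_surjective (f := fun l : List A => (⟨Subtype.val '' {x | x ∈ l},
    l.finite_toSet.image _, ?_⟩ : {t : Set σ | t.Finite ∧ t ⊆ A})) ?_).trans h
  · rintro _ ⟨x, -, rfl⟩
    exact x.2
  · rintro ⟨t, ht, htA⟩
    have hfin : (Subtype.val ⁻¹' t : Set A).Finite := ht.preimage Subtype.val_injective.injOn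
    refine ⟨hfin.toFinset.toList, Subtype.ext ?_⟩
    have : {x : A | x ∈ hfin.toFinset.toList} = Subtype.val ⁻¹' t := by ext; simp
    change Subtype.val '' {x : A | x ∈ hfin.toFinset.toList} = t
    rw [this, Subtype.image_preimage_coe, inter_eq_right.2 htA]

end AdequateSets

open AdequateSets in
theorem proposition4p4
    (h_pow : (2 : Cardinal.{0}) ^ ℵ_ 1 = ℵ_ 2)
    (π : Iio (ω_ 2 : Ordinal.{0}) ≃ AdequateSets.HOmegaTwo)
    (Y : Set (Set Ordinal.{0}))
    (hY_stationary : AdequateSets.IsStationaryCountable Y)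
    (hY_thin : AdequateSets.IsThin Y)
    (hY_initial : AdequateSets.InitialSegmentClosed Y)
    (S : Set (Σ n : ℕ, (Fin n → AdequateSets.HOmegaTwo) → AdequateSets.HOmegaTwo))
    (hS : AdequateSets.IsDefinableSkolemSet π Y S)
    (Γ : Set Ordinal.{0})
    (hΓ_subset : Γ ⊆ AdequateSets.Lam S)
    (hΓ_stationary : IsStationary {β : Iio (ω_ 2 : Ordinal.{0}) | (β : Ordinal.{0}) ∈ Γ}) :
    AdequateSets.IsCC (AdequateSets.Condition Y S Γ) (ℵ_ 2) := by
  intro A hA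
  by_contra hcard
  have hYc := hY_stationary.1
  obtain ⟨⟨g, hg⟩⟩ : Nonempty (Iio (ω_ 2 : Ordinal.{0}) ↪ A) := by
    rw [← Cardinal.le_def, Cardinal.mk_Iio_ordinal, Ordinal.card_omega, Cardinal.lift_aleph,
      Ordinal.lift_ofNat]
    exact not_lt.1 hcard
  let p : Ordinal.{0} → Set (Set Ordinal.{0}) := fun β =>
    if hβ : β < ω_ 2 then (g ⟨β, hβ⟩).1.models else ∅
  have hp : ∀ β (hβ : β < ω_ 2), p β = (g ⟨β, hβ⟩).1.models := fun β hβ => dif_pos hβ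
  have hcount : ∀ β, β < ω_ 2 → (⋃₀ p β).Countable ∧ ⋃₀ p β ⊆ Iio (ω_ 2) := by
    intro β hβ
    rw [hp β hβ]
    exact ⟨(g ⟨β, hβ⟩).1.finite.countable.sUnion fun M hM =>
      (hYc ((g ⟨β, hβ⟩).1.adequate.1 hM).1).2, sUnion_subset fun M hM =>
      (hYc ((g ⟨β, hβ⟩).1.adequate.1 hM).1).1⟩
  obtain ⟨t, ht⟩ := exists_unbounded_fiber hΓ_stationary
    (fun β => (fun M : Set Ordinal.{0} => M ∩ Iio β) '' p β)
    (fun η => {t | t.Finite ∧ t ⊆ (fun a : Set Ordinal.{0} => a ∩ Iio η) '' Y})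
    (fun η hη => mk_finite_subsets_le (hY_thin η hη)) (by
      intro β hβ hβ2
      obtain ⟨η, hη, hb⟩ := exists_bound_of_cof (hΓ_subset hβ).2.1
        ((hcount β hβ2).1.mono inter_subset_left) (inter_subset_right (s := ⋃₀ p β) (t := Iio β))
      refine ⟨η, hη, ?_, ?_⟩
      · rw [hp β hβ2]
        exact (g ⟨β, hβ2⟩).1.finite.image _
      · rintro _ ⟨M, hM, rfl⟩
        have hMY : M ∈ Y := by
          rw [hp β hβ2] at hM
          exact ((g ⟨β, hβ2⟩).1.adequate.1 hM).1
        exact ⟨M ∩ Iio β, hY_initial M hMY β hβ2,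
          inter_eq_left.2 fun α hα => hb α ⟨⟨M, hM, hα.1⟩, hα.2⟩⟩)
  -- The lower point is chosen first, so that β can be taken above both β' and every ordinal
  -- occurring in `p β'`.
  obtain ⟨β', hβ', hβ'2, -, rfl⟩ := ht 0 (Ordinal.omega_pos 2)
  obtain ⟨γ, hγ, hγp⟩ := exists_bound_lt_omega_two
    ((Cardinal.le_aleph0_iff_set_countable.2 (hcount β' hβ'2).1).trans
      (Cardinal.aleph0_le_aleph 1)) (hcount β' hβ'2).2
  obtain ⟨β, hβ, hβ2, hlt, heq⟩ := ht (max γ β') (max_lt hγ hβ'2)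
  have hle : β' ≤ β := (le_max_right _ _).trans hlt.le
  set P := g ⟨β, hβ2⟩ with hP
  set P' := g ⟨β', hβ'2⟩ with hP'
  simp only [hp β hβ2, hp β' hβ'2] at heq hγp
  have hcross : ∀ M ∈ P.1.models, ∀ N ∈ P'.1.models,
      ComparableAt S M N (comparisonPoint Γ M N) := by
    intro M hM N hN
    obtain ⟨M', hM', hMM'⟩ := heq.subset ⟨M, hM, rfl⟩
    exact comparableAt_comparisonPoint hS hYc hY_thin hY_initial hΓ_subset hβ hβ' hle
      (P.1.adequate.1 hM) (P'.1.adequate.1 hM') (P'.1.adequate.1 hN) hMM'.symm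
      (fun α hα => (hγp α ⟨N, hN, hα⟩).trans ((le_max_left _ _).trans_lt hlt))
      (P'.1.adequate.2 M' hM' N hN)
  refine hA P.1 P.2 P'.1 P'.2 (fun h => ?_) ⟨⟨P.1.models ∪ P'.1.models,
    P.1.finite.union P'.1.finite, union_subset P.1.adequate.1 P'.1.adequate.1, ?_⟩,
    subset_union_left, subset_union_right⟩
  · exact ((le_max_right _ _).trans_lt hlt).ne' (congrArg Subtype.val (hg (Subtype.ext h)))
  · rintro M (hM | hM) N (hN | hN)
    · exact P.1.adequate.2 M hM N hN
    · exact hcross M hM N hN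
    · have := (hcross N hN M hM).symm
      rwa [comparisonPoint_comm] at this
    · exact P'.1.adequate.2 M hM N hN
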